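/- Let $\mathcal R$ denote Riemann's auxiliary function, the entire function $$\mathcal R(s)=\int_{0\swarrow 1}\frac{x^{-s}e^{\pi i x^2}}{e^{\pi i x}-e^{-\pi i x}}\,dx\qquad(s\in\mathbb C),$$ where $x^{-s}=e^{-s\log x}$ with the principal branch of the logarithm, and the path of integration $0\swarrow1$ is the straight line $\{\tfrac12+ue^{\pi i/4}:u\in\mathbb R\}$, which crosses the real axis between $0$ and $1$, traversed from the upper right to the lower left. Then for all real $\sigma>0$ and $t>16\pi$, $$|\mathcal R(\sigma+it)|\le 2\sqrt{\frac{t}{2\pi}}.$$ -/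

import Mathlib

/-- The integrand `x ^ (-s) * exp (π i x²) / (exp (π i x) - exp (-π i x))` of Riemann's auxiliary
function, with the principal branch of `x ^ (-s)` (cut along the non-positive real axis). -/
noncomputable def auxIntegrand (s x : ℂ) : ℂ :=
  x ^ (-s) * Complex.exp (Real.pi * Complex.I * x ^ 2) /
    (Complex.exp (Real.pi * Complex.I * x) - Complex.exp (-(Real.pi * Complex.I * x)))

/-- The straight line of direction `exp (π i / 4)` that meets the real axis at `1 / 2`,
parametrized from the lower left to the upper right. It avoids the branch cut and the integers. -/
noncomputable def auxLine (u : ℝ) : ℂ :=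
  1 / 2 + u * Complex.exp (Real.pi * Complex.I / 4)

/-- Riemann's auxiliary function `R(s) = ∫_{0 ↙ 1} x^(-s) e^(π i x²) / (e^(π i x) - e^(-π i x)) dx`.
The path comes from infinity at the upper right and goes to infinity at the lower left, opposite to
`auxLine`, hence the minus sign. The integral converges absolutely for every `s`. -/
noncomputable def riemannAux (s : ℂ) : ℂ :=
  -∫ u : ℝ, auxIntegrand s (auxLine u) * Complex.exp (Real.pi * Complex.I / 4)

/-!
Write `t = 2πa²` and `N = ⌊a⌋`. Moving the line of integration to the right across the poles
`1, …, N` extracts `∑ n ≤ N, n ^ (-s)`, which is at most `N` in absolute value. To pass the pole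
`n` it is enough to know the kernel `auxIntegrand 0`: the difference
`auxIntegrand s x - n ^ (-s) * auxIntegrand 0 x` has a removable singularity there, while
`auxIntegrand 0 (x + 1) - auxIntegrand 0 x = exp (π i x² + π i x)` makes the jump of the kernel a
Gaussian integral.

On the line through `b = N + 1/2`, close to the saddle point `a`, the integrand has size at most
`exp (t arg x - 2π x.re x.im) / 2`. The inequality `arg x ≤ x.im / (x.re - x.im)`, valid for
`0 ≤ x.re`, turns the exponent into a quadratic polynomial in `x.im` with maximum `πκ²/2`, where
`κ = a²/b - b`; the part with `x.re < 0` is negligible since `arg x ≤ -π/2` there. Hence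
`|R(s)| ≤ N + (exp (πκ²/2) + exp (-π²a²)) / 2`, which is at most `2a`.
-/

open Complex MeasureTheory Filter Topology Asymptotics Bornology Set
open scoped Interval Real

/-! ### Moving the line of integration -/

section ContourShift

variable {E : Type*} [NormedAddCommGroup E] [NormedSpace ℂ E] {F : ℂ → E} {y₁ y₂ : ℝ}

theorem tendsto_integral_vertical_segment_cobounded
    (hF : Tendsto F (cobounded ℂ ⊓ 𝓟 {z | z.im ∈ [[y₁, y₂]]}) (𝓝 0)) :
    Tendsto (fun R : ℝ => ∫ y in y₁..y₂, F (R + y * I)) (cobounded ℝ) (𝓝 0) := by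
  rw [NormedAddGroup.tendsto_nhds_zero] at hF ⊢
  intro ε hε
  have hL : 0 < |y₂ - y₁| + 1 := by positivity
  obtain ⟨r, -, hr⟩ := (hasBasis_cobounded_norm.inf_principal _).eventually_iff.1
    (hF (ε / (|y₂ - y₁| + 1)) (by positivity))
  filter_upwards [eventually_cobounded_le_norm r] with R hR
  have hbound : ∀ y ∈ Ι y₁ y₂, ‖F (R + y * I)‖ ≤ ε / (|y₂ - y₁| + 1) := by
    refine fun y hy => (hr ⟨hR.trans ?_, ?_⟩).le
    · simpa using abs_re_le_norm (R + y * I : ℂ)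
    · simpa using uIoc_subset_uIcc hy
  calc ‖∫ y in y₁..y₂, F (R + y * I)‖
      ≤ ε / (|y₂ - y₁| + 1) * |y₂ - y₁| := intervalIntegral.norm_integral_le_of_norm_le_const hbound
    _ < ε := by rw [div_mul_eq_mul_div, div_lt_iff₀ hL]; nlinarith

theorem integral_horizontal_line_eq (hd : DifferentiableOn ℂ F {z | z.im ∈ [[y₁, y₂]]})
    (h₁ : Integrable fun u : ℝ => F (u + y₁ * I)) (h₂ : Integrable fun u : ℝ => F (u + y₂ * I))
    (hF : Tendsto F (cobounded ℂ ⊓ 𝓟 {z | z.im ∈ [[y₁, y₂]]}) (𝓝 0)) :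
    ∫ u : ℝ, F (u + y₁ * I) = ∫ u : ℝ, F (u + y₂ * I) := by
  have hrect (R : ℝ) :
      (∫ u in (-R)..R, F (u + y₁ * I)) - (∫ u in (-R)..R, F (u + y₂ * I)) =
        I • (∫ y in y₁..y₂, F ((-R : ℝ) + y * I)) - I • ∫ y in y₁..y₂, F (R + y * I) := by
    have hzero := integral_boundary_rect_eq_zero_of_differentiableOn F
      ((-R : ℝ) + y₁ * I) (R + y₂ * I) (hd.mono fun z hz => by simpa using hz.2)
    simp only [add_re, ofReal_re, mul_re, ofReal_im, I_re, I_im, add_im, mul_im,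
      mul_zero, mul_one, sub_zero, add_zero, zero_add] at hzero
    rw [← sub_eq_zero, ← hzero]
    abel
  have hsides := tendsto_integral_vertical_segment_cobounded hF
  have hright := hsides.comp (IsOrderBornology.atTop_le_cobounded (α := ℝ))
  have hleft := hsides.comp
    (tendsto_neg_atTop_atBot.mono_right (IsOrderBornology.atBot_le_cobounded (α := ℝ)))
  have hends := (hleft.const_smul I).sub (hright.const_smul I)
  rw [smul_zero, sub_zero] at hends
  have hlines :=
    (intervalIntegral_tendsto_integral h₁ tendsto_neg_atTop_atBot tendsto_id).sub
      (intervalIntegral_tendsto_integral h₂ tendsto_neg_atTop_atBot tendsto_id)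
  exact sub_eq_zero.1 (tendsto_nhds_unique (hlines.congr hrect) hends)

end ContourShift

/-! ### Integrals along oblique lines -/

/-- The line of direction `exp (π i / 4)` that meets the real axis at `b`; it is the set of `x` with
`x.re - x.im = b`. -/
noncomputable def obliqueLine (b u : ℝ) : ℂ := b + u * cexp (π * I / 4)

/-- The closed strip between `obliqueLine b` and `obliqueLine c`. -/
def obliqueStrip (b c : ℝ) : Set ℂ := {x | x.re - x.im ∈ Icc b c}

theorem exp_pi_mul_I_div_four_re : (cexp (π * I / 4)).re = √2 / 2 := by
  rw [show (π * I / 4 : ℂ) = ((π / 4 : ℝ) : ℂ) * I by push_cast; ring, exp_ofReal_mul_I_re,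
    Real.cos_pi_div_four]

theorem exp_pi_mul_I_div_four_im : (cexp (π * I / 4)).im = √2 / 2 := by
  rw [show (π * I / 4 : ℂ) = ((π / 4 : ℝ) : ℂ) * I by push_cast; ring, exp_ofReal_mul_I_im,
    Real.sin_pi_div_four]

theorem exp_pi_mul_I_div_four_sq : cexp (π * I / 4) ^ 2 = I := by
  rw [← Complex.exp_nat_mul, show ((2 : ℕ) : ℂ) * (π * I / 4) = (π / 2 : ℂ) * I by push_cast; ring,
    exp_pi_div_two_mul_I]

theorem norm_exp_pi_mul_I_div_four : ‖cexp (π * I / 4)‖ = 1 := by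
  rw [show (π * I / 4 : ℂ) = ((π / 4 : ℝ) : ℂ) * I by push_cast; ring, norm_exp_ofReal_mul_I]

theorem obliqueLine_re (b u : ℝ) : (obliqueLine b u).re = √2 / 2 * u + b := by
  simp only [obliqueLine, add_re, re_ofReal_mul, ofReal_re, exp_pi_mul_I_div_four_re]
  ring

theorem obliqueLine_im (b u : ℝ) : (obliqueLine b u).im = √2 / 2 * u := by
  simp only [obliqueLine, add_im, im_ofReal_mul, ofReal_im, exp_pi_mul_I_div_four_im]
  ring

theorem obliqueLine_re_sub_im (b u : ℝ) : (obliqueLine b u).re - (obliqueLine b u).im = b := by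
  rw [obliqueLine_re, obliqueLine_im]
  ring

theorem obliqueLine_add_one (b u : ℝ) : obliqueLine (b + 1) u = obliqueLine b u + 1 := by
  simp only [obliqueLine]
  push_cast
  ring

theorem obliqueLine_mem_obliqueStrip {a b c : ℝ} (hb : b ∈ Icc a c) (u : ℝ) :
    obliqueLine b u ∈ obliqueStrip a c := by
  simpa only [obliqueStrip, mem_ofPred_eq, obliqueLine_re_sub_im] using hb

theorem add_exp_mul_eq_obliqueLine (b c u : ℝ) :
    b + cexp (π * I / 4) * (u + (-((c - b) * (√2 / 2)) : ℝ) * I) =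
      obliqueLine c (u - (c - b) * (√2 / 2)) := by
  apply Complex.ext
  · rw [obliqueLine_re]
    simp only [add_re, mul_re, add_im, mul_im, ofReal_re, ofReal_im, I_re, I_im,
      exp_pi_mul_I_div_four_re, exp_pi_mul_I_div_four_im]
    linear_combination (c - b) / 2 * Real.mul_self_sqrt zero_le_two
  · rw [obliqueLine_im]
    simp only [add_re, mul_re, add_im, mul_im, ofReal_re, ofReal_im, I_re, I_im,
      exp_pi_mul_I_div_four_re, exp_pi_mul_I_div_four_im]
    ring

theorem add_exp_mul_re_sub_im (b : ℝ) (z : ℂ) :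
    (b + cexp (π * I / 4) * z).re - (b + cexp (π * I / 4) * z).im = b - √2 * z.im := by
  simp only [add_re, mul_re, add_im, mul_im, ofReal_re, ofReal_im,
    exp_pi_mul_I_div_four_re, exp_pi_mul_I_div_four_im]
  ring

theorem isometry_obliqueLine (b : ℝ) : Isometry (obliqueLine b) := by
  refine Isometry.of_dist_eq fun u v => ?_
  rw [dist_eq_norm, dist_eq_norm, obliqueLine, obliqueLine, add_sub_add_left_eq_sub, ← sub_mul,
    norm_mul, norm_exp_pi_mul_I_div_four, mul_one, ← ofReal_sub, norm_real]

theorem tendsto_obliqueLine_cocompact {a b c : ℝ} (hb : b ∈ Icc a c) :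
    Tendsto (obliqueLine b) (cocompact ℝ) (cobounded ℂ ⊓ 𝓟 (obliqueStrip a c)) := by
  rw [← Metric.cobounded_eq_cocompact]
  exact tendsto_inf.2 ⟨(isometry_obliqueLine b).antilipschitz.tendsto_cobounded,
    tendsto_principal.2 (.of_forall (obliqueLine_mem_obliqueStrip hb))⟩

theorem isBigO_exp_neg_norm_obliqueLine_sq (b : ℝ) (l : Filter ℝ) :
    (fun u => Real.exp (-‖obliqueLine b u‖ ^ 2)) =O[l] fun u => Real.exp (-(1 / 2) * u ^ 2) := by
  refine .of_norm_le fun u => ?_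
  rw [Real.norm_eq_abs, Real.abs_exp, Real.exp_le_exp]
  have him : |(obliqueLine b u).im| ^ 2 ≤ ‖obliqueLine b u‖ ^ 2 := by
    gcongr
    exact abs_im_le_norm _
  rw [sq_abs, obliqueLine_im, mul_pow, div_pow, Real.sq_sqrt zero_le_two] at him
  linarith

theorem tendsto_exp_neg_norm_sq_cobounded {V : Type*} [NormedAddCommGroup V] :
    Tendsto (fun x : V => Real.exp (-‖x‖ ^ 2)) (cobounded V) (𝓝 0) :=
  Real.tendsto_exp_atBot.comp <| tendsto_neg_atTop_atBot.comp <|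
    (tendsto_pow_atTop two_ne_zero).comp tendsto_norm_cobounded_atTop

section ObliqueShift

variable {E : Type*} [NormedAddCommGroup E] {H : ℂ → E} {a b c : ℝ}

theorem integrable_obliqueLine (hb : b ∈ Icc a c) (hcont : Continuous fun u => H (obliqueLine b u))
    (hO : H =O[cobounded ℂ ⊓ 𝓟 (obliqueStrip a c)] fun x => Real.exp (-‖x‖ ^ 2)) :
    Integrable fun u => H (obliqueLine b u) :=
  hcont.locallyIntegrable.integrable_of_isBigO_cocompact
    ((hO.comp_tendsto (tendsto_obliqueLine_cocompact hb)).trans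
      (isBigO_exp_neg_norm_obliqueLine_sq b _))
    ((integrable_exp_neg_mul_sq one_half_pos).integrableAtFilter _)

theorem integral_obliqueLine_eq [NormedSpace ℂ E] (hbc : b ≤ c)
    (hd : DifferentiableOn ℂ H (obliqueStrip b c))
    (hO : H =O[cobounded ℂ ⊓ 𝓟 (obliqueStrip b c)] fun x => Real.exp (-‖x‖ ^ 2)) :
    ∫ u, H (obliqueLine b u) = ∫ u, H (obliqueLine c u) := by
  have hint {d : ℝ} (h : d ∈ Icc b c) : Integrable fun u => H (obliqueLine d u) :=
    integrable_obliqueLine h (hd.continuousOn.comp_continuous (isometry_obliqueLine d).continuous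
      (obliqueLine_mem_obliqueStrip h)) hO
  set φ : ℂ → ℂ := fun z => b + cexp (π * I / 4) * z
  set y : ℝ → ℝ := fun d => -((d - b) * (√2 / 2)) with hy
  have hline (d u : ℝ) : H (φ (u + y d * I)) = H (obliqueLine d (u - (d - b) * (√2 / 2))) :=
    congrArg H (add_exp_mul_eq_obliqueLine b d u)
  have hmaps : MapsTo φ {z | z.im ∈ [[y b, y c]]} (obliqueStrip b c) := by
    intro z hz
    have hyc : y c ≤ 0 := neg_nonpos.2 (mul_nonneg (sub_nonneg.2 hbc) (by positivity))
    have hyb : y b = 0 := by simp [hy]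
    have hsqrt : √2 * y c = b - c := by
      linear_combination (b - c) / 2 * Real.mul_self_sqrt zero_le_two
    obtain ⟨hlow, hup⟩ : y c ≤ z.im ∧ z.im ≤ 0 := by simpa [hyb, uIcc_of_ge hyc] using hz
    have hre := add_exp_mul_re_sub_im b z
    constructor <;> nlinarith [Real.sqrt_nonneg 2]
  have htendsto : Tendsto φ (cobounded ℂ ⊓ 𝓟 {z | z.im ∈ [[y b, y c]]})
      (cobounded ℂ ⊓ 𝓟 (obliqueStrip b c)) :=
    ((tendsto_const_add_cobounded (b : ℂ)).comp
      (tendsto_mul_left_cobounded (Complex.exp_ne_zero _))).inf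
      (tendsto_principal_principal.2 hmaps)
  have hdecay : Tendsto (H ∘ φ) (cobounded ℂ ⊓ 𝓟 {z | z.im ∈ [[y b, y c]]}) (𝓝 0) :=
    (hO.trans_tendsto (tendsto_exp_neg_norm_sq_cobounded.mono_left inf_le_left)).comp htendsto
  have hint' {d : ℝ} (h : d ∈ Icc b c) : Integrable fun u : ℝ => (H ∘ φ) (u + y d * I) := by
    simpa only [Function.comp_apply, hline] using (hint h).comp_sub_right ((d - b) * (√2 / 2))
  have hshift := integral_horizontal_line_eq (hd.comp (by fun_prop) hmaps)
    (hint' (left_mem_Icc.2 hbc)) (hint' (right_mem_Icc.2 hbc)) hdecay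
  simp only [Function.comp_apply, hline] at hshift
  rwa [integral_sub_right_eq_self fun u => H (obliqueLine b u),
    integral_sub_right_eq_self fun u => H (obliqueLine c u)] at hshift

end ObliqueShift

/-! ### Residues of the integrand -/

theorem exists_differentiableOn_eq_div {f g : ℂ → ℂ} {U : Set ℂ} {c : ℂ} (hU : U ∈ 𝓝 c)
    (hf : DifferentiableOn ℂ f U) (hg : DifferentiableOn ℂ g U) (hfc : f c = 0) (hgc : g c = 0)
    (hg' : deriv g c ≠ 0) (hg0 : ∀ x ∈ U, x ≠ c → g x ≠ 0) :
    ∃ H : ℂ → ℂ, DifferentiableOn ℂ H U ∧ ∀ x ≠ c, H x = f x / g x := by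
  refine ⟨fun x => dslope f c x / dslope g c x, ?_, fun x hx => ?_⟩
  · refine ((differentiableOn_dslope hU).2 hf).div ((differentiableOn_dslope hU).2 hg)
      fun x hx => ?_
    rcases eq_or_ne x c with rfl | hxc
    · rwa [dslope_same]
    · rw [dslope_of_ne _ hxc, slope_def_field, hgc, sub_zero]
      exact div_ne_zero (hg0 x hx hxc) (sub_ne_zero.2 hxc)
  · simp only [dslope_of_ne _ hx, slope_def_field, hfc, hgc, sub_zero]
    exact div_div_div_cancel_right₀ (sub_ne_zero.2 hx) _ _

/-- The denominator `exp (π i x) - exp (-π i x) = 2 i sin (π x)` of `auxIntegrand`. -/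
noncomputable def auxDenom (x : ℂ) : ℂ := cexp (π * I * x) - cexp (-(π * I * x))

theorem auxDenom_eq (x : ℂ) : auxDenom x = 2 * I * Complex.sin (π * x) := by
  rw [auxDenom, Complex.sin, show -(π * x : ℂ) * I = -(π * I * x) by ring,
    show (π * x : ℂ) * I = π * I * x by ring]
  linear_combination (cexp (π * I * x) - cexp (-(π * I * x))) * I_sq

theorem norm_auxDenom_sq (x : ℂ) :
    ‖auxDenom x‖ ^ 2 = 4 * (Real.sin (π * x.re) ^ 2 + Real.sinh (π * x.im) ^ 2) := by
  have harg : (π * x : ℂ) = ((π * x.re : ℝ) : ℂ) + ((π * x.im : ℝ) : ℂ) * I := by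
    conv_lhs => rw [← re_add_im x]
    push_cast
    ring
  rw [auxDenom_eq, harg, Complex.sin_add_mul_I, ← ofReal_sin, ← ofReal_cos, ← ofReal_cosh,
    ← ofReal_sinh, ← ofReal_mul, ← ofReal_mul, norm_mul, mul_pow, norm_mul, norm_I,
    Complex.sq_norm (_ + _), normSq_add_mul_I, Complex.norm_ofNat, mul_pow, mul_pow, Real.cosh_sq]
  linear_combination 4 * Real.sinh (π * x.im) ^ 2 * Real.sin_sq_add_cos_sq (π * x.re)

theorem sq_le_sinh_sq (y : ℝ) : y ^ 2 ≤ Real.sinh y ^ 2 := by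
  rw [sq_le_sq, Real.abs_sinh]
  exact Real.self_le_sinh_iff.2 (abs_nonneg y)

theorem two_le_norm_auxDenom_of_one_le_abs_im {x : ℂ} (hx : 1 ≤ |x.im|) : 2 ≤ ‖auxDenom x‖ := by
  have hpi : 1 ≤ (π * x.im) ^ 2 := by
    rw [one_le_sq_iff_one_le_abs, abs_mul, abs_of_pos Real.pi_pos]
    exact one_le_mul_of_one_le_of_one_le (by linarith [Real.pi_gt_three]) hx
  refine (pow_le_pow_iff_left₀ zero_le_two (norm_nonneg _) two_ne_zero).1 ?_
  rw [norm_auxDenom_sq]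
  linarith [sq_le_sinh_sq (π * x.im), sq_nonneg (Real.sin (π * x.re))]

theorem two_le_norm_auxDenom_obliqueLine (n : ℤ) (u : ℝ) :
    2 ≤ ‖auxDenom (obliqueLine (n + 1 / 2) u)‖ := by
  have hsin : Real.sin (π * (√2 / 2 * u + (n + 1 / 2))) ^ 2 = Real.cos (π * (√2 / 2 * u)) ^ 2 := by
    rw [show π * (√2 / 2 * u + (n + 1 / 2)) = π * (√2 / 2 * u) + π / 2 + n * π by ring,
      Real.sin_add_int_mul_pi, mul_pow, ← zpow_natCast, ← zpow_mul, mul_comm n, zpow_mul,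
      Nat.cast_ofNat, even_two.neg_one_zpow, one_zpow, one_mul, Real.sin_add_pi_div_two]
  refine (pow_le_pow_iff_left₀ zero_le_two (norm_nonneg _) two_ne_zero).1 ?_
  rw [norm_auxDenom_sq, obliqueLine_re, obliqueLine_im, hsin]
  linarith [Real.sin_sq_add_cos_sq (π * (√2 / 2 * u)), sq_le_sinh_sq (π * (√2 / 2 * u)),
    sq_le_sq.2 (Real.abs_sin_le_abs (x := π * (√2 / 2 * u)))]

theorem auxDenom_add_one (x : ℂ) : auxDenom (x + 1) = -auxDenom x := by
  rw [auxDenom_eq, auxDenom_eq, mul_add, mul_one, Complex.sin_add_pi, mul_neg]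

theorem auxDenom_eq_zero_iff {x : ℂ} : auxDenom x = 0 ↔ ∃ m : ℤ, x = m := by
  have hpi : (π : ℂ) ≠ 0 := ofReal_ne_zero.2 Real.pi_ne_zero
  rw [auxDenom_eq, mul_eq_zero_iff_left (mul_ne_zero two_ne_zero I_ne_zero),
    Complex.sin_eq_zero_iff]
  refine exists_congr fun m => ?_
  rw [mul_comm, mul_left_inj' hpi]

theorem hasDerivAt_auxDenom (x : ℂ) :
    HasDerivAt auxDenom (2 * I * (Complex.cos (π * x) * π)) x := by
  rw [funext auxDenom_eq]
  exact ((hasDerivAt_const_mul (π : ℂ)).csin).const_mul _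

theorem differentiable_auxDenom : Differentiable ℂ auxDenom :=
  fun x => (hasDerivAt_auxDenom x).differentiableAt

theorem deriv_auxDenom_ne_zero {x : ℂ} (hx : auxDenom x = 0) : deriv auxDenom x ≠ 0 := by
  have hsin : Complex.sin (π * x) = 0 := by simpa [auxDenom_eq] using hx
  have hcos : Complex.cos (π * x) ≠ 0 := fun h => by
    simpa [hsin, h] using Complex.sin_sq_add_cos_sq (π * x)
  rw [(hasDerivAt_auxDenom x).deriv]
  simp [hcos, Real.pi_ne_zero]

theorem auxDenom_ne_zero_of_re_sub_im {x : ℂ} (hx : x.re - x.im ∉ range ((↑) : ℤ → ℝ)) :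
    auxDenom x ≠ 0 := by
  rw [Ne, auxDenom_eq_zero_iff]
  rintro ⟨m, rfl⟩
  exact hx ⟨m, by simp⟩

theorem auxIntegrand_eq (s x : ℂ) :
    auxIntegrand s x = x ^ (-s) * cexp (π * I * x ^ 2) / auxDenom x := rfl

theorem norm_exp_pi_mul_I_mul_sq (x : ℂ) :
    ‖cexp (π * I * x ^ 2)‖ = Real.exp (-(2 * π * (x.re * x.im))) := by
  rw [norm_exp]
  congr 1
  simp only [sq, mul_re, mul_im, ofReal_re, ofReal_im, I_re, I_im]
  ring

theorem neg_two_mul_re_mul_im_le {b c : ℝ} {x : ℂ} (hx : x ∈ obliqueStrip b c) :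
    -(2 * (x.re * x.im)) ≤ max |b| |c| ^ 2 - ‖x‖ ^ 2 := by
  have hsq : (x.re - x.im) ^ 2 ≤ max |b| |c| ^ 2 :=
    sq_le_sq.2 ((abs_le_max_abs_abs hx.1 hx.2).trans (le_abs_self _))
  rw [← normSq_eq_norm_sq, normSq_apply]
  linarith

theorem norm_cpow_le_of_one_le_norm {x : ℂ} (hx : 1 ≤ ‖x‖) (w : ℂ) :
    ‖x ^ w‖ ≤ Real.exp ((‖x‖ + π) * ‖w‖) := by
  have hlog : ‖log x‖ ≤ ‖x‖ + π :=
    calc ‖log x‖ ≤ |(log x).re| + |(log x).im| := norm_le_abs_re_add_abs_im _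
      _ ≤ ‖x‖ + π := by
        rw [log_re, log_im, abs_of_nonneg (Real.log_nonneg hx)]
        exact add_le_add (Real.log_le_self (norm_nonneg x)) (abs_arg_le_pi x)
  rw [cpow_def_of_ne_zero (norm_pos_iff.1 (one_pos.trans_le hx))]
  refine (norm_exp_le_exp_norm _).trans (Real.exp_le_exp.2 ?_)
  rw [norm_mul]
  gcongr

theorem one_le_abs_im_of_mem_obliqueStrip {b c : ℝ} {x : ℂ} (hx : x ∈ obliqueStrip b c)
    (hx' : max |b| |c| + 2 ≤ ‖x‖) : 1 ≤ |x.im| := by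
  have hre : |x.re - x.im| ≤ max |b| |c| := abs_le_max_abs_abs hx.1 hx.2
  linarith [norm_le_abs_re_add_abs_im x, abs_sub_abs_le_abs_sub x.re x.im]

theorem isBigO_auxIntegrand (s : ℂ) (b c : ℝ) :
    auxIntegrand s =O[cobounded ℂ ⊓ 𝓟 (obliqueStrip b c)] fun x => Real.exp (-‖x‖ ^ 2) := by
  set M := max |b| |c|
  refine .of_bound (Real.exp (π * M ^ 2 + (‖s‖ ^ 2 + π * ‖s‖))) ?_
  filter_upwards [(eventually_cobounded_le_norm (M + 2)).filter_mono inf_le_left,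
    mem_inf_of_right (mem_principal_self _)] with x hxM hx
  have hM0 : 0 ≤ M := (abs_nonneg b).trans (le_max_left _ _)
  have hdenom : 1 ≤ ‖auxDenom x‖ := one_le_two.trans <|
    two_le_norm_auxDenom_of_one_le_abs_im (one_le_abs_im_of_mem_obliqueStrip hx hxM)
  calc ‖auxIntegrand s x‖
      = ‖x ^ (-s)‖ * Real.exp (π * -(2 * (x.re * x.im))) / ‖auxDenom x‖ := by
        rw [auxIntegrand_eq, norm_div, norm_mul, norm_exp_pi_mul_I_mul_sq]
        ring_nf
    _ ≤ ‖x ^ (-s)‖ * Real.exp (π * -(2 * (x.re * x.im))) := div_le_self (by positivity) hdenom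
    _ ≤ Real.exp ((‖x‖ + π) * ‖-s‖) * Real.exp (π * (M ^ 2 - ‖x‖ ^ 2)) := by
        gcongr
        · exact norm_cpow_le_of_one_le_norm (by linarith) (-s)
        · exact neg_two_mul_re_mul_im_le hx
    _ ≤ Real.exp (π * M ^ 2 + (‖s‖ ^ 2 + π * ‖s‖)) * Real.exp (-‖x‖ ^ 2) := by
        rw [norm_neg, ← Real.exp_add, ← Real.exp_add, Real.exp_le_exp]
        nlinarith [sq_nonneg (‖x‖ - ‖s‖ / 2), mul_nonneg (sub_nonneg.2 Real.two_le_pi)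
          (sq_nonneg ‖x‖), sq_nonneg ‖s‖]
    _ = Real.exp (π * M ^ 2 + (‖s‖ ^ 2 + π * ‖s‖)) * ‖Real.exp (-‖x‖ ^ 2)‖ := by
        rw [Real.norm_eq_abs, Real.abs_exp]

theorem mem_slitPlane_of_im_lt_re {x : ℂ} (hx : x.im < x.re) : x ∈ slitPlane := by
  rw [mem_slitPlane_iff]
  by_contra! h
  linarith [h.1, h.2]

theorem differentiableAt_cpow_neg_mul_exp (s : ℂ) {x : ℂ} (hx : x ∈ slitPlane) :
    DifferentiableAt ℂ (fun x => x ^ (-s) * cexp (π * I * x ^ 2)) x :=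
  ((hasDerivAt_id x).cpow_const hx).differentiableAt.mul (by fun_prop)

theorem integrable_auxIntegrand_obliqueLine (s : ℂ) {b : ℝ} (hb : 0 < b)
    (hb' : b ∉ range ((↑) : ℤ → ℝ)) : Integrable fun u => auxIntegrand s (obliqueLine b u) := by
  refine integrable_obliqueLine (left_mem_Icc.2 le_rfl) ?_ (isBigO_auxIntegrand s b b)
  refine continuous_iff_continuousAt.2 fun u => ?_
  have hline := obliqueLine_re_sub_im b u
  have hdiff : DifferentiableAt ℂ (auxIntegrand s) (obliqueLine b u) :=
    (differentiableAt_cpow_neg_mul_exp s (mem_slitPlane_of_im_lt_re (by linarith))).div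
      differentiable_auxDenom.differentiableAt (auxDenom_ne_zero_of_re_sub_im (by rwa [hline]))
  exact hdiff.continuousAt.comp (isometry_obliqueLine b).continuous.continuousAt

theorem auxIntegrand_zero_add_one_sub {x : ℂ} (hx : auxDenom x ≠ 0) :
    auxIntegrand 0 (x + 1) - auxIntegrand 0 x = cexp (π * I * x ^ 2 + π * I * x) := by
  have hsq : cexp (π * I * (x + 1) ^ 2) =
      -(cexp (π * I * x ^ 2 + π * I * x) * cexp (π * I * x)) := by
    rw [← Complex.exp_add, ← neg_one_mul, ← exp_pi_mul_I, ← Complex.exp_add]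
    ring_nf
  have hinv : cexp (π * I * x ^ 2) = cexp (π * I * x ^ 2 + π * I * x) * cexp (-(π * I * x)) := by
    rw [← Complex.exp_add, add_neg_cancel_right]
  rw [auxIntegrand_eq, auxIntegrand_eq, auxDenom_add_one, hsq, neg_zero, cpow_zero,
    cpow_zero, one_mul, one_mul, neg_div_neg_eq, ← sub_div, div_eq_iff hx, hinv, auxDenom, mul_sub,
    ← hinv]

theorem integral_exp_quadratic_obliqueLine (b : ℝ) :
    (∫ u, cexp (π * I * obliqueLine b u ^ 2 + π * I * obliqueLine b u)) * cexp (π * I / 4) = 1 := by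
  have hpi : (π : ℂ) ≠ 0 := ofReal_ne_zero.2 Real.pi_ne_zero
  have hsq := exp_pi_mul_I_div_four_sq
  set ω := cexp (π * I / 4) with hω
  have hquad (u : ℝ) : π * I * obliqueLine b u ^ 2 + π * I * obliqueLine b u =
      (-π : ℂ) * u ^ 2 + (π * I * ω * (2 * b + 1)) * u + π * I * (b ^ 2 + b) := by
    rw [obliqueLine, ← hω]
    linear_combination π * I * u ^ 2 * hsq + π * u ^ 2 * I_sq
  have hexponent :
      π * I * (b ^ 2 + b) - (π * I * ω * (2 * b + 1)) ^ 2 / (4 * -π) + π * I / 4 = 0 := by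
    field_simp
    linear_combination π * (2 * b + 1) ^ 2 * I ^ 2 * hsq + π * (2 * b + 1) ^ 2 * I * I_sq
  simp only [hquad]
  rw [integral_cexp_quadratic (by simpa using Real.pi_pos), neg_neg, div_self hpi, one_cpow,
    one_mul, hω, ← Complex.exp_add, ← hω, hexponent, Complex.exp_zero]

theorem add_one_notMem_range_intCast {b : ℝ} (hb : b ∉ range ((↑) : ℤ → ℝ)) :
    b + 1 ∉ range ((↑) : ℤ → ℝ) := fun ⟨m, hm⟩ =>
  hb ⟨m - 1, by push_cast; linarith⟩

theorem integral_auxIntegrand_zero_add_one_sub {b : ℝ} (hb : 0 < b)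
    (hb' : b ∉ range ((↑) : ℤ → ℝ)) :
    ((∫ u, auxIntegrand 0 (obliqueLine (b + 1) u)) - ∫ u, auxIntegrand 0 (obliqueLine b u)) *
      cexp (π * I / 4) = 1 := by
  rw [← integral_sub (integrable_auxIntegrand_obliqueLine 0 (by positivity)
      (add_one_notMem_range_intCast hb')) (integrable_auxIntegrand_obliqueLine 0 hb hb'),
    ← integral_exp_quadratic_obliqueLine b]
  congr 2 with u
  rw [obliqueLine_add_one, auxIntegrand_zero_add_one_sub]
  exact auxDenom_ne_zero_of_re_sub_im (by rwa [obliqueLine_re_sub_im])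

theorem notMem_range_intCast_of_mem_Ioo {n : ℤ} {b : ℝ} (hb : b ∈ Ioo (n : ℝ) (n + 1)) :
    b ∉ range ((↑) : ℤ → ℝ) := by
  rintro ⟨m, rfl⟩
  have hnm : n < m := by exact_mod_cast hb.1
  have hmn : m < n + 1 := by exact_mod_cast hb.2
  omega

theorem natCast_succ_eq_of_mem_obliqueStrip {n : ℕ} {b : ℝ} (hb : b ∈ Ioo (n : ℝ) (n + 1)) {x : ℂ}
    (hx : x ∈ obliqueStrip b (b + 1)) (hx' : auxDenom x = 0) : x = (n + 1 : ℕ) := by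
  obtain ⟨m, rfl⟩ := auxDenom_eq_zero_iff.1 hx'
  obtain ⟨hbm, hmb⟩ : b ≤ m ∧ (m : ℝ) ≤ b + 1 := by simpa [obliqueStrip] using hx
  have hnm : (n : ℤ) < m := by exact_mod_cast hb.1.trans_le hbm
  have hmn : m < (n : ℤ) + 2 := by
    have hlt : (m : ℝ) < n + 2 := by linarith [hb.2]
    exact_mod_cast hlt
  obtain rfl : m = n + 1 := by omega
  push_cast
  rfl

theorem exists_differentiableOn_auxIntegrand_sub (s : ℂ) {n : ℕ} {b : ℝ}
    (hb : b ∈ Ioo (n : ℝ) (n + 1)) :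
    ∃ H : ℂ → ℂ, DifferentiableOn ℂ H (obliqueStrip b (b + 1)) ∧ ∀ x ≠ ((n + 1 : ℕ) : ℂ),
      H x = auxIntegrand s x - ((n + 1 : ℕ) : ℂ) ^ (-s) * auxIntegrand 0 x := by
  set c : ℂ := ((n + 1 : ℕ) : ℂ) with hc
  have hslit {x : ℂ} (hx : x ∈ obliqueStrip b (b + 1)) : x ∈ slitPlane :=
    mem_slitPlane_of_im_lt_re <| sub_pos.1 <| (n.cast_nonneg.trans_lt hb.1).trans_le hx.1
  have hnhds : obliqueStrip b (b + 1) ∈ 𝓝 c := by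
    refine (continuous_re.sub continuous_im).continuousAt (Icc_mem_nhds ?_ ?_)
    · simpa [hc] using hb.2
    · simpa [hc] using hb.1
  have hzero : auxDenom c = 0 := auxDenom_eq_zero_iff.2 ⟨n + 1, by push_cast [hc]; rfl⟩
  obtain ⟨H, hHd, hH⟩ := exists_differentiableOn_eq_div
    (f := fun x => x ^ (-s) * cexp (π * I * x ^ 2) - c ^ (-s) * cexp (π * I * x ^ 2)) hnhds
    (fun x hx => ((differentiableAt_cpow_neg_mul_exp s (hslit hx)).sub
      (by fun_prop)).differentiableWithinAt)
    differentiable_auxDenom.differentiableOn (sub_self _) hzero (deriv_auxDenom_ne_zero hzero)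
    fun x hx hxc hx0 => hxc (natCast_succ_eq_of_mem_obliqueStrip hb hx hx0)
  refine ⟨H, hHd, fun x hx => ?_⟩
  rw [hH x hx, auxIntegrand_eq, auxIntegrand_eq, neg_zero, cpow_zero, one_mul, sub_div,
    mul_div_assoc (c ^ (-s))]

theorem integral_auxIntegrand_add_one_sub (s : ℂ) {n : ℕ} {b : ℝ} (hb : b ∈ Ioo (n : ℝ) (n + 1)) :
    ((∫ u, auxIntegrand s (obliqueLine (b + 1) u)) - ∫ u, auxIntegrand s (obliqueLine b u)) *
      cexp (π * I / 4) = ((n + 1 : ℕ) : ℂ) ^ (-s) := by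
  have hb0 : 0 < b := n.cast_nonneg.trans_lt hb.1
  have hb' : b ∉ range ((↑) : ℤ → ℝ) :=
    notMem_range_intCast_of_mem_Ioo (n := n) (by exact_mod_cast hb)
  set q : ℂ := ((n + 1 : ℕ) : ℂ) ^ (-s)
  obtain ⟨H, hHd, hH⟩ := exists_differentiableOn_auxIntegrand_sub s hb
  have hdecay : H =O[cobounded ℂ ⊓ 𝓟 (obliqueStrip b (b + 1))] fun x => Real.exp (-‖x‖ ^ 2) := by
    refine ((isBigO_auxIntegrand s b (b + 1)).sub
      ((isBigO_auxIntegrand 0 b (b + 1)).const_mul_left q)).congr' ?_ .rfl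
    filter_upwards [inf_le_left (b := 𝓟 (obliqueStrip b (b + 1)))
      (eventually_ne_cobounded ((n + 1 : ℕ) : ℂ))] with x hx using (hH x hx).symm
  have hline {d : ℝ} (hd0 : 0 < d) (hd : d ∉ range ((↑) : ℤ → ℝ)) :
      ∫ u, H (obliqueLine d u) = (∫ u, auxIntegrand s (obliqueLine d u)) -
        q * ∫ u, auxIntegrand 0 (obliqueLine d u) := by
    rw [← integral_const_mul, ← integral_sub (integrable_auxIntegrand_obliqueLine s hd0 hd)
      ((integrable_auxIntegrand_obliqueLine 0 hd0 hd).const_mul q)]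
    refine integral_congr_ae (.of_forall fun u => hH _ fun hu => hd ⟨n + 1, ?_⟩)
    simpa [hu] using obliqueLine_re_sub_im d u
  have hshift := integral_obliqueLine_eq (by linarith) hHd hdecay
  rw [hline hb0 hb', hline (by positivity) (add_one_notMem_range_intCast hb')] at hshift
  linear_combination
    q * integral_auxIntegrand_zero_add_one_sub hb0 hb' - cexp (π * I / 4) * hshift

theorem riemannAux_eq_sum_sub_integral (s : ℂ) (N : ℕ) :
    riemannAux s = ∑ k ∈ Finset.range N, ((k + 1 : ℕ) : ℂ) ^ (-s) -
      (∫ u, auxIntegrand s (obliqueLine (N + 1 / 2) u)) * cexp (π * I / 4) := by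
  induction N with
  | zero =>
    have hline : auxLine = obliqueLine ((0 : ℕ) + 1 / 2) := by
      funext u
      simp [auxLine, obliqueLine]
    rw [riemannAux, integral_mul_const, hline, Finset.sum_range_zero, zero_sub]
  | succ N ih =>
    have hres := integral_auxIntegrand_add_one_sub s (n := N) (b := N + 1 / 2)
      ⟨by linarith, by linarith⟩
    rw [ih, Finset.sum_range_succ, ← hres, Nat.cast_succ, add_right_comm]
    ring

theorem norm_riemannAux_le {s : ℂ} (hs : 0 ≤ s.re) (N : ℕ) :
    ‖riemannAux s‖ ≤ N + ∫ u, ‖auxIntegrand s (obliqueLine (N + 1 / 2) u)‖ := by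
  have hterm (k : ℕ) : ‖((k + 1 : ℕ) : ℂ) ^ (-s)‖ ≤ 1 := by
    rw [norm_natCast_cpow_of_pos k.succ_pos, neg_re]
    exact Real.rpow_le_one_of_one_le_of_nonpos (by simp) (neg_nonpos.2 hs)
  rw [riemannAux_eq_sum_sub_integral s N]
  refine (norm_sub_le _ _).trans (add_le_add ?_ ?_)
  · simpa using norm_sum_le_of_le (Finset.range N) fun k _ => hterm k
  · rw [norm_mul, norm_exp_pi_mul_I_div_four, mul_one]
    exact norm_integral_le_integral_norm _

/-! ### The integral near the saddle point -/

theorem mul_cos_le_sin {θ : ℝ} (h0 : 0 ≤ θ) (hθ : θ ≤ π / 2) : θ * Real.cos θ ≤ Real.sin θ := by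
  rcases hθ.lt_or_eq with hlt | rfl
  · have hcos : 0 < Real.cos θ := Real.cos_pos_of_mem_Ioo ⟨by linarith, hlt⟩
    rw [← le_div_iff₀ hcos, ← Real.tan_eq_sin_div_cos]
    exact Real.le_tan h0 hlt
  · rw [Real.cos_pi_div_two, Real.sin_pi_div_two, mul_zero]
    exact zero_le_one

theorem arg_mul_re_sub_im_le {x : ℂ} (hx : 0 ≤ x.re) : arg x * (x.re - x.im) ≤ x.im := by
  have hsin : ‖x‖ * Real.sin (arg x) = x.im := norm_mul_sin_arg x
  have hcos : ‖x‖ * Real.cos (arg x) = x.re := norm_mul_cos_arg x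
  rcases le_total 0 x.im with him | him
  · have harg : 0 ≤ arg x := arg_nonneg_iff.2 him
    have htan := mul_cos_le_sin harg (le_of_abs_le (abs_arg_le_pi_div_two_iff.2 hx))
    calc arg x * (x.re - x.im) ≤ arg x * x.re := by gcongr; linarith
      _ = ‖x‖ * (arg x * Real.cos (arg x)) := by rw [← hcos]; ring
      _ ≤ ‖x‖ * Real.sin (arg x) := by gcongr
      _ = x.im := hsin
  · have harg : arg x ≤ 0 := by
      rcases him.lt_or_eq with hneg | hzero
      · exact (arg_neg_iff.2 hneg).le
      · exact (arg_eq_zero_iff.2 ⟨hx, hzero⟩).le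
    have hle : arg x ≤ Real.sin (arg x) := by
      simpa [Real.sin_neg] using Real.sin_le (neg_nonneg.2 harg)
    calc arg x * (x.re - x.im) ≤ arg x * ‖x‖ := by
          refine mul_le_mul_of_nonpos_left ?_ harg
          have htri := norm_le_abs_re_add_abs_im x
          rwa [abs_of_nonneg hx, abs_of_nonpos him, ← sub_eq_add_neg] at htri
      _ = ‖x‖ * arg x := mul_comm _ _
      _ ≤ ‖x‖ * Real.sin (arg x) := by gcongr
      _ = x.im := hsin

theorem arg_le_neg_pi_div_two {x : ℂ} (hre : x.re < 0) (him : x.im < 0) : arg x ≤ -(π / 2) := by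
  by_contra! harg
  exact hre.not_ge (abs_arg_le_pi_div_two_iff.1
    (abs_le.2 ⟨harg.le, (arg_neg_iff.2 him).le.trans Real.pi_div_two_pos.le⟩))

theorem mul_arg_sub_re_mul_im_le_of_re_nonneg {τ : ℝ} {x : ℂ} (hτ : 0 ≤ τ) (hx : x.im < x.re)
    (hre : 0 ≤ x.re) :
    τ * arg x - x.re * x.im ≤ (τ / (x.re - x.im) - (x.re - x.im)) ^ 2 / 4 -
      (x.im - (τ / (x.re - x.im) - (x.re - x.im)) / 2) ^ 2 := by
  have harg : arg x ≤ x.im / (x.re - x.im) :=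
    (le_div_iff₀ (sub_pos.2 hx)).2 (arg_mul_re_sub_im_le hre)
  calc τ * arg x - x.re * x.im ≤ τ * (x.im / (x.re - x.im)) - x.re * x.im := by gcongr
    _ = _ := by ring

theorem mul_arg_sub_re_mul_im_le_of_re_neg {τ : ℝ} {x : ℂ} (hτ : 0 ≤ τ) (hx : x.im < x.re)
    (hre : x.re < 0) : τ * arg x - x.re * x.im ≤ -(τ * (π / 2)) - x.re ^ 2 := by
  have harg := mul_le_mul_of_nonneg_left (arg_le_neg_pi_div_two hre (hx.trans hre)) hτ
  have hsq := mul_le_mul_of_nonpos_left hx.le hre.le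
  linarith

theorem norm_auxIntegrand {x : ℂ} (hx : x ≠ 0) (s : ℂ) :
    ‖auxIntegrand s x‖ =
      ‖x‖ ^ (-s.re) * Real.exp (s.im * arg x - 2 * π * (x.re * x.im)) / ‖auxDenom x‖ := by
  rw [auxIntegrand_eq, norm_div, norm_mul, norm_cpow_of_ne_zero hx, norm_exp_pi_mul_I_mul_sq,
    neg_re, neg_im, mul_neg, Real.exp_neg (arg x * s.im), div_inv_eq_mul, mul_assoc, ← Real.exp_add,
    mul_comm (arg x), ← sub_eq_add_neg]

theorem norm_auxIntegrand_le {s x : ℂ} {τ : ℝ} (hs : 0 ≤ s.re) (hsτ : s.im = 2 * π * τ)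
    (hτ : 0 ≤ τ) (hx : x.im < x.re) (hnorm : 1 ≤ ‖x‖) (hdenom : 2 ≤ ‖auxDenom x‖) :
    ‖auxIntegrand s x‖ ≤
      (Real.exp (π / 2 * (τ / (x.re - x.im) - (x.re - x.im)) ^ 2) *
          Real.exp (-(2 * π) * (x.im - (τ / (x.re - x.im) - (x.re - x.im)) / 2) ^ 2) +
        Real.exp (-(π ^ 2 * τ)) * Real.exp (-(2 * π) * x.re ^ 2)) / 2 := by
  rw [norm_auxIntegrand (norm_pos_iff.1 (one_pos.trans_le hnorm))]
  refine div_le_div₀ (by positivity) ?_ two_pos hdenom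
  refine (mul_le_of_le_one_left (Real.exp_nonneg _)
    (Real.rpow_le_one_of_one_le_of_nonpos hnorm (neg_nonpos.2 hs))).trans ?_
  rw [← Real.exp_add, ← Real.exp_add,
    show s.im * arg x - 2 * π * (x.re * x.im) = 2 * π * (τ * arg x - x.re * x.im) by
      rw [hsτ]; ring]
  have hpi := Real.two_pi_pos.le
  rcases le_or_gt 0 x.re with hre | hre
  · refine le_add_of_le_of_nonneg (Real.exp_le_exp.2 ?_) (Real.exp_nonneg _)
    linarith [mul_le_mul_of_nonneg_left (mul_arg_sub_re_mul_im_le_of_re_nonneg hτ hx hre) hpi]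
  · refine le_add_of_nonneg_of_le (Real.exp_nonneg _) (Real.exp_le_exp.2 ?_)
    linarith [mul_le_mul_of_nonneg_left (mul_arg_sub_re_mul_im_le_of_re_neg hτ hx hre) hpi]

theorem exp_neg_two_pi_mul_sq_eq (c u : ℝ) :
    Real.exp (-(2 * π) * (√2 / 2 * u + c) ^ 2) = Real.exp (-π * (u + √2 * c) ^ 2) := by
  congr 1
  linear_combination -(π * u ^ 2 / 2 - π * c ^ 2) * Real.mul_self_sqrt zero_le_two

theorem integrable_exp_neg_two_pi_mul_sq (c : ℝ) :
    Integrable fun u : ℝ => Real.exp (-(2 * π) * (√2 / 2 * u + c) ^ 2) := by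
  simp only [exp_neg_two_pi_mul_sq_eq]
  exact (integrable_exp_neg_mul_sq Real.pi_pos).comp_add_right (√2 * c)

theorem integral_exp_neg_two_pi_mul_sq (c : ℝ) :
    ∫ u : ℝ, Real.exp (-(2 * π) * (√2 / 2 * u + c) ^ 2) = 1 := by
  simp only [exp_neg_two_pi_mul_sq_eq]
  rw [integral_add_right_eq_self fun u => Real.exp (-π * u ^ 2), integral_gaussian,
    div_self Real.pi_ne_zero, Real.sqrt_one]

theorem one_le_norm_of_le_re_sub_im {x : ℂ} (hx : 3 / 2 ≤ x.re - x.im) : 1 ≤ ‖x‖ := by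
  have hsq : 1 ≤ ‖x‖ ^ 2 := by
    rw [← normSq_eq_norm_sq, normSq_apply]
    nlinarith [sq_nonneg (x.re + x.im)]
  nlinarith [norm_nonneg x]

theorem integral_norm_auxIntegrand_le {s : ℂ} {τ : ℝ} (hs : 0 ≤ s.re) (hsτ : s.im = 2 * π * τ)
    (hτ : 0 ≤ τ) {N : ℕ} (hN : 1 ≤ N) :
    ∫ u, ‖auxIntegrand s (obliqueLine (N + 1 / 2) u)‖ ≤
      (Real.exp (π / 2 * (τ / (N + 1 / 2) - (N + 1 / 2)) ^ 2) + Real.exp (-(π ^ 2 * τ))) / 2 := by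
  have hN' : (1 : ℝ) ≤ N := by exact_mod_cast hN
  set b : ℝ := N + 1 / 2 with hb
  set κ : ℝ := τ / b - b
  have hmain := (integrable_exp_neg_two_pi_mul_sq (-(κ / 2))).const_mul
    (Real.exp (π / 2 * κ ^ 2))
  have htail := (integrable_exp_neg_two_pi_mul_sq b).const_mul (Real.exp (-(π ^ 2 * τ)))
  have hint : Integrable fun u => auxIntegrand s (obliqueLine b u) :=
    integrable_auxIntegrand_obliqueLine s (by positivity) <|
      notMem_range_intCast_of_mem_Ioo (n := N) (by rw [Int.cast_natCast]; constructor <;> linarith)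
  refine (integral_mono hint.norm ((hmain.add htail).div_const 2) fun u => ?_).trans_eq ?_
  · have hline := obliqueLine_re_sub_im b u
    have hpoint := norm_auxIntegrand_le (x := obliqueLine b u) hs hsτ hτ (by linarith)
      (one_le_norm_of_le_re_sub_im (by linarith))
      (by simpa [hb] using two_le_norm_auxDenom_obliqueLine N u)
    rwa [hline, obliqueLine_im, obliqueLine_re, sub_eq_add_neg _ (κ / 2)] at hpoint
  · simp only [Pi.add_apply]
    rw [integral_div, integral_add hmain htail, integral_const_mul, integral_const_mul,
      integral_exp_neg_two_pi_mul_sq, integral_exp_neg_two_pi_mul_sq, mul_one, mul_one]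

/-! ### Numerical bounds -/

theorem exp_three_halves_le : Real.exp (3 / 2) ≤ 4.5 := by
  refine (pow_le_pow_iff_left₀ (Real.exp_nonneg _) (by norm_num) two_ne_zero).1 ?_
  calc Real.exp (3 / 2) ^ 2 = Real.exp 1 ^ 3 := by
        rw [← Real.exp_nat_mul, ← Real.exp_nat_mul]
        norm_num
    _ ≤ 2.7182818286 ^ 3 := by
        gcongr
        exact Real.exp_one_lt_d9.le
    _ ≤ 4.5 ^ 2 := by norm_num

theorem exp_le_div_five_halves_sub {y : ℝ} (hy : y < 5 / 2) : Real.exp y ≤ 4.5 / (5 / 2 - y) := by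
  have hinv : Real.exp (y - 3 / 2) ≤ (5 / 2 - y)⁻¹ := by
    rw [← inv_inv (Real.exp _), ← Real.exp_neg]
    exact inv_anti₀ (by linarith) (by linarith [Real.add_one_le_exp (-(y - 3 / 2))])
  calc Real.exp y = Real.exp (3 / 2) * Real.exp (y - 3 / 2) := by rw [← Real.exp_add]; ring_nf
    _ ≤ 4.5 * (5 / 2 - y)⁻¹ := by gcongr; exact exp_three_halves_le
    _ = 4.5 / (5 / 2 - y) := (div_eq_mul_inv _ _).symm

theorem exp_pi_div_two_mul_sq_le {κ r : ℝ} (hκ : |κ| ≤ r) (hr : 1.5708 * r ^ 2 < 5 / 2) :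
    Real.exp (π / 2 * κ ^ 2) ≤ 4.5 / (5 / 2 - 1.5708 * r ^ 2) := by
  have hsq : κ ^ 2 ≤ r ^ 2 := sq_le_sq.2 (hκ.trans (le_abs_self r))
  have hpi : π / 2 ≤ 1.5708 := by linarith [Real.pi_lt_d4]
  exact (Real.exp_le_exp.2 (by gcongr)).trans (exp_le_div_five_halves_sub hr)

theorem exp_neg_pi_sq_mul_sq_le {a : ℝ} (ha : 2 ≤ a) : Real.exp (-(π ^ 2 * a ^ 2)) ≤ 1 / 20 := by
  have hbase : 36 ≤ π ^ 2 * a ^ 2 :=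
    calc (36 : ℝ) = 3 ^ 2 * 2 ^ 2 := by norm_num
      _ ≤ π ^ 2 * a ^ 2 := by gcongr; exact Real.pi_gt_three.le
  rw [Real.exp_neg, one_div]
  exact inv_anti₀ (by norm_num) (by linarith [Real.add_one_le_exp (π ^ 2 * a ^ 2)])

theorem exp_add_exp_le_of_floor {a : ℝ} {N : ℕ} (ha : 2 ≤ a) (hN : N ≤ a) (hN' : a < N + 1) :
    Real.exp (π / 2 * (a ^ 2 / (N + 1 / 2) - (N + 1 / 2)) ^ 2) + Real.exp (-(π ^ 2 * a ^ 2)) ≤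
      2 * (2 * a - N) := by
  have htail := exp_neg_pi_sq_mul_sq_le ha
  have hN2 : 2 ≤ N := by
    have hlt : (1 : ℝ) < N := by linarith
    exact_mod_cast hlt
  have hb : (0 : ℝ) < N + 1 / 2 := by positivity
  have hκ {r : ℝ} (hlow : (N + 1 / 2 - r) * (N + 1 / 2) ≤ a ^ 2)
      (hup : a ^ 2 ≤ (N + 1 / 2 + r) * (N + 1 / 2)) :
      |a ^ 2 / (N + 1 / 2) - (N + 1 / 2)| ≤ r :=
    abs_sub_le_iff.2 ⟨by linarith [(div_le_iff₀ hb).2 hup], by linarith [(le_div_iff₀ hb).2 hlow]⟩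
  rcases le_or_gt ((N : ℝ) + 9 / 10) a with hge | hlt
  · have hN2' : (2 : ℝ) ≤ N := by exact_mod_cast hN2
    have hmain := (exp_pi_div_two_mul_sq_le (r := 1.1) (hκ (by nlinarith) (by nlinarith))
      (by norm_num)).trans (by norm_num : _ ≤ (7.55 : ℝ))
    linarith
  · rcases hN2.eq_or_lt with rfl | hN3
    · push_cast at hlt hκ ⊢
      have hmain := (exp_pi_div_two_mul_sq_le (r := 0.9) (hκ (by nlinarith) (by nlinarith))
        (by norm_num)).trans (by norm_num : _ ≤ (3.9 : ℝ))
      linarith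
    · have hN3' : (3 : ℝ) ≤ N := by exact_mod_cast hN3
      have hmain := (exp_pi_div_two_mul_sq_le (r := 1) (hκ (by nlinarith) (by nlinarith))
        (by norm_num)).trans (by norm_num : _ ≤ (5.9 : ℝ))
      linarith

theorem mainTheorem3_general (σ t : ℝ) (hσ : 0 ≤ σ) (ht : 8 * Real.pi ≤ t) :
    ‖riemannAux ((σ : ℂ) + (t : ℂ) * Complex.I)‖ ≤ 2 * Real.sqrt (t / (2 * Real.pi)) := by
  set s : ℂ := σ + t * I
  set a : ℝ := √(t / (2 * π))
  have hs : 0 ≤ s.re := by simpa [s] using hσ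
  have hquot : 4 ≤ t / (2 * π) := by
    rw [le_div_iff₀ Real.two_pi_pos]
    linarith
  have hsq : a ^ 2 = t / (2 * π) := Real.sq_sqrt (by linarith)
  have hsa : s.im = 2 * π * a ^ 2 := by
    rw [hsq, mul_div_cancel₀ t Real.two_pi_pos.ne']
    simp [s]
  have ha : 2 ≤ a := Real.le_sqrt_of_sq_le (by linarith)
  have hN : 1 ≤ ⌊a⌋₊ := Nat.le_floor (by push_cast; linarith)
  have hline := norm_riemannAux_le hs ⌊a⌋₊
  have hsaddle := integral_norm_auxIntegrand_le hs hsa (sq_nonneg a) hN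
  have hexp := exp_add_exp_le_of_floor ha (Nat.floor_le (by linarith)) (Nat.lt_floor_add_one a)
  linarith

theorem mainTheorem3 (σ t : ℝ) (hσ : 0 < σ) (ht : 16 * Real.pi < t) :
    ‖riemannAux ((σ : ℂ) + (t : ℂ) * Complex.I)‖ ≤ 2 * Real.sqrt (t / (2 * Real.pi)) :=
  mainTheorem3_general σ t hσ.le (by linarith [Real.pi_pos])
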